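/- A bounded domain is a bounded, nonempty, connected open set $\Omega\subset\mathbb{C}$. It has $C^2$ boundary if near each of its points the boundary $\partial\Omega$ is, after a rotation of the axes, the graph of a twice continuously differentiable real function of one real variable. For $P\in\partial\Omega$ let $\nu_P$ denote the unit outward normal to $\partial\Omega$ at $P$, let $\delta_\Omega(z)$ denote the Euclidean distance from $z$ to $\partial\Omega$, and for $\alpha>1$ put $$\Gamma_\alpha(P)=\{z\in\Omega : |z-P|<\alpha\,\delta_\Omega(z)\}.$$ A function $f$ on $\Omega$ has radial limit $\ell$ at $P$ if $\lim_{t\to0^+}f(P-t\nu_P)=\ell$, and it has nontangential limit $\ell$ at $P$ if $\lim_{\Gamma_\alpha(P)\ni z\to P}f(z)=\ell$ for every $\alpha>1$. **Theorem 19.** Let $\Omega_1,\Omega_2\subset\mathbb{C}$ be bounded domains with $C^2$ boundary and let $f:\Omega_1\to\Omega_2$ be holomorphic. Let $P\in\partial\Omega_1$ and $Q\in\partial\Omega_2$. If $f$ has radial limit $Q$ at $P$, then $f$ has nontangential limit $Q$ at $P$. -/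

import Mathlib

open Set Filter Topology

/-- A bounded domain in the plane: a bounded, nonempty, connected open set. -/
structure IsBoundedDomain (Ω : Set ℂ) : Prop where
  isOpen : IsOpen Ω
  isConnected : IsConnected Ω
  isBounded : Bornology.IsBounded Ω

/-- `Ω` has `C²` boundary: near each boundary point `p`, after moving `p` to the origin and
rotating the axes by some unit complex number `u`, the boundary is the graph of a function of one
real variable that is twice continuously differentiable near `0`. -/
def HasC2Boundary (Ω : Set ℂ) : Prop :=
  ∀ p ∈ frontier Ω, ∃ (u : ℂ) (φ : ℝ → ℝ), ‖u‖ = 1 ∧ ContDiffAt ℝ 2 φ 0 ∧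
    ∀ᶠ z in 𝓝 p, z ∈ frontier Ω ↔ ((z - p) / u).im = φ ((z - p) / u).re

/-- `ν` is the unit outward normal at `P` to the boundary of `Ω`: a unit vector, orthogonal to the
tangent vectors of the boundary at `P`, such that `P - t ν` is inside `Ω` and `P + t ν` is
outside the closure of `Ω` for all small `t > 0`. -/
structure IsUnitOutwardNormal (Ω : Set ℂ) (P ν : ℂ) : Prop where
  norm_eq_one : ‖ν‖ = 1
  orthogonal : ∀ v ∈ tangentConeAt ℝ (frontier Ω) P, inner ℝ ν v = 0
  inside : ∀ᶠ t : ℝ in 𝓝[>] 0, P - (t : ℂ) * ν ∈ Ω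
  outside : ∀ᶠ t : ℝ in 𝓝[>] 0, P + (t : ℂ) * ν ∉ closure Ω

/-- `f` has radial limit `l` at the boundary point `P` of `Ω`: the limit along the inward
normal segment at `P` is `l`. -/
def HasRadialLimit (Ω : Set ℂ) (f : ℂ → ℂ) (P l : ℂ) : Prop :=
  ∃ ν : ℂ, IsUnitOutwardNormal Ω P ν ∧
    Tendsto (fun t : ℝ => f (P - (t : ℂ) * ν)) (𝓝[>] 0) (𝓝 l)

/-- The nontangential approach region of aperture `α` at the boundary point `P` of `Ω`. -/
def approachRegion (Ω : Set ℂ) (α : ℝ) (P : ℂ) : Set ℂ :=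
  {z | z ∈ Ω ∧ ‖z - P‖ < α * Metric.infDist z (frontier Ω)}

/-- `f` has nontangential limit `l` at the boundary point `P` of `Ω`. -/
def HasNontangentialLimit (Ω : Set ℂ) (f : ℂ → ℂ) (P l : ℂ) : Prop :=
  ∀ α : ℝ, 1 < α → Tendsto f (𝓝[approachRegion Ω α P] P) (𝓝 l)

/-! Write z = P - ζν, so that the boundary is tangent to Re ζ = 0. Differentiability of the boundary
at P (`HasC2Boundary.tangent_line`) and connectedness of sectors put every sector c‖ζ‖ ≤ Re ζ inside
Ω₁ near P and its mirror image outside the closure. Hence each approach region is eventually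
contained in such a sector. As Ω₂ is bounded, f is bounded, and the claim becomes Lindelöf's theorem
in a sector. Half of a sector is an exponential image of a strip, with the axis as one edge. If g is
at most δ on the axis and M elsewhere, Hadamard's three lines theorem bounds it by δ^(1-x) M^x,
where x stays away from 1 on smaller sectors. -/

/-! ### Lindelöf's theorem in a sector -/

theorem Complex.abs_arg_le_arccos {c : ℝ} {z : ℂ} (hz : z ≠ 0) (h : c * ‖z‖ ≤ z.re) :
    |z.arg| ≤ Real.arccos c := by
  have hc : c ≤ Real.cos |z.arg| := by
    rw [Real.cos_abs]
    refine le_of_mul_le_mul_right ?_ (norm_pos_iff.2 hz)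
    rwa [mul_comm (Real.cos _), Complex.norm_mul_cos_arg]
  rw [← Real.arccos_cos (abs_nonneg z.arg) (Complex.abs_arg_le_pi z)]
  exact Real.arccos_le_arccos hc

theorem Complex.mul_norm_inv_le_re_inv {c : ℝ} {z : ℂ} (h : c * ‖z‖ ≤ z.re) :
    c * ‖z⁻¹‖ ≤ (z⁻¹).re := by
  rcases eq_or_ne z 0 with rfl | hz
  · simp
  · have hn := norm_pos_iff.2 hz
    rw [Complex.inv_re, Complex.normSq_eq_norm_sq, norm_inv, le_div_iff₀ (by positivity)]
    calc c * ‖z‖⁻¹ * ‖z‖ ^ 2 = c * ‖z‖ := by field_simp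
      _ ≤ z.re := h

/-- A two-constants estimate on one side of a truncated sector, transported to the reciprocal
variable `w⁻¹ - r⁻¹`. -/
theorem Complex.norm_le_interp_of_truncated_sector {g : ℂ → ℂ} {β b r δ M : ℝ}
    (hβ : β < Real.pi / 2) (hβ0 : 0 < β) (hb : |b| = β) (hr : 0 < r)
    (hg : ∀ ζ : ℂ, ζ ≠ 0 → ‖ζ‖ < r → Real.cos β * ‖ζ‖ ≤ ζ.re →
      DifferentiableAt ℂ g ζ ∧ ‖g ζ‖ ≤ M)
    (hδ : ∀ t : ℝ, 0 < t → t < r → ‖g t‖ ≤ δ)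
    {η : ℂ} (hη : η ≠ 0) (hs0 : 0 ≤ η.arg / b) (hs1 : η.arg / b ≤ 1) :
    ‖g (η + (r : ℂ)⁻¹)⁻¹‖ ≤ δ ^ (1 - η.arg / b) * M ^ (η.arg / b) := by
  have hb0 : b ≠ 0 := by rintro rfl; simp at hb; linarith
  have hbC : (b : ℂ) ≠ 0 := by exact_mod_cast hb0
  have hcos : 0 < Real.cos β := Real.cos_pos_of_mem_Ioo ⟨by linarith, hβ⟩
  -- `E s` has angle b Re s: the edge Re s = 0 goes to the positive axis, Re s = 1 to the ray of
  -- angle b.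
  set E : ℂ → ℂ := fun s => Complex.exp (s * (b * Complex.I)) with hE
  have hEre : ∀ s : ℂ, 0 ≤ s.re → s.re ≤ 1 → Real.cos β * ‖E s‖ ≤ (E s).re := by
    intro s h0 h1
    have him : (s * (b * Complex.I)).im = s.re * b := by simp
    rw [hE]
    simp only
    rw [Complex.norm_exp, Complex.exp_re, him, mul_comm, ← Real.cos_abs (s.re * b)]
    refine mul_le_mul_of_nonneg_left ?_ (Real.exp_pos _).le
    refine Real.cos_le_cos_of_nonneg_of_le_pi (abs_nonneg _) (by linarith [Real.pi_pos]) ?_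
    rw [abs_mul, hb, abs_of_nonneg h0]
    nlinarith
  -- Adding 1/r stays in the sector and makes the real part exceed 1/r, so the reciprocal has norm
  -- below r: a truncation that fixes the real axis.
  have key : ∀ s : ℂ, 0 ≤ s.re → s.re ≤ 1 → (E s + (r : ℂ)⁻¹) ≠ 0 ∧
      ‖(E s + (r : ℂ)⁻¹)⁻¹‖ < r ∧
      Real.cos β * ‖(E s + (r : ℂ)⁻¹)⁻¹‖ ≤ ((E s + (r : ℂ)⁻¹)⁻¹).re := by
    intro s h0 h1
    have h := hEre s h0 h1
    have hEp : 0 < ‖E s‖ := norm_pos_iff.2 (Complex.exp_ne_zero _)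
    have hre : (E s + (r : ℂ)⁻¹).re = (E s).re + r⁻¹ := by
      rw [← Complex.ofReal_inv]; simp
    have hnr : ‖(r : ℂ)⁻¹‖ = r⁻¹ := by simp [abs_of_pos hr]
    have hEr : 0 < (E s).re := lt_of_lt_of_le (by positivity) h
    have hr' : 0 < r⁻¹ := inv_pos.2 hr
    have hlt : r⁻¹ < ‖E s + (r : ℂ)⁻¹‖ :=
      lt_of_lt_of_le (by rw [hre]; linarith) (Complex.re_le_norm _)
    refine ⟨norm_pos_iff.1 (hr'.trans hlt), ?_, Complex.mul_norm_inv_le_re_inv ?_⟩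
    · rw [norm_inv]; exact inv_lt_of_inv_lt₀ hr hlt
    · rw [hre]
      have h2 := norm_add_le (E s) (r : ℂ)⁻¹
      rw [hnr] at h2
      have h3 := mul_le_mul_of_nonneg_left h2 hcos.le
      have h4 := Real.cos_le_one β
      nlinarith
  have hEdiff : Differentiable ℂ E := by
    rw [hE]; fun_prop
  set G : ℂ → ℂ := fun s => g (E s + (r : ℂ)⁻¹)⁻¹ with hG
  have hGd : ∀ s : ℂ, 0 ≤ s.re → s.re ≤ 1 → DifferentiableAt ℂ G s ∧ ‖G s‖ ≤ M := by
    intro s h0 h1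
    obtain ⟨k1, k2, k3⟩ := key s h0 h1
    obtain ⟨d1, d2⟩ := hg _ (inv_ne_zero k1) k2 k3
    refine ⟨?_, d2⟩
    have : DifferentiableAt ℂ (fun s => (E s + (r : ℂ)⁻¹)⁻¹) s :=
      ((hEdiff s).add_const _).inv k1
    exact DifferentiableAt.comp s d1 this
  have hEs : E (Complex.log η / (b * Complex.I)) = η := by
    rw [hE]
    simp only
    rw [div_mul_cancel₀ _ (mul_ne_zero hbC Complex.I_ne_zero), Complex.exp_log hη]
  have hsre : (Complex.log η / (b * Complex.I)).re = η.arg / b := by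
    have : Complex.log η / (b * Complex.I) = (-Complex.I * Complex.log η) / b := by
      field_simp
      rw [Complex.I_sq]; ring
    rw [this, Complex.div_ofReal_re]
    simp [Complex.log_im]
  have hcl : closure (Complex.HadamardThreeLines.verticalStrip 0 1) =
      Complex.HadamardThreeLines.verticalClosedStrip 0 1 := by
    rw [Complex.HadamardThreeLines.verticalStrip, Complex.HadamardThreeLines.verticalClosedStrip,
      Complex.closure_preimage_re, closure_Ioo zero_ne_one]
  have main := Complex.HadamardThreeLines.norm_le_interp_of_mem_verticalClosedStrip₀₁'
    (f := G) (z := Complex.log η / (b * Complex.I)) (a := δ) (b := M)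
    ⟨by rw [hsre]; exact hs0, by rw [hsre]; exact hs1⟩
    ⟨fun s hs => (hGd s hs.1.le hs.2.le).1.differentiableWithinAt, by
      rw [hcl]
      exact fun s hs => (hGd s hs.1 hs.2).1.continuousAt.continuousWithinAt⟩
    ⟨M, by rintro _ ⟨s, hs, rfl⟩; exact (hGd s hs.1 hs.2).2⟩
    (fun s hs => by
      have hs : s.re = 0 := hs
      obtain ⟨k1, k2, k3⟩ := key s hs.ge (by linarith)
      have hreal : (E s + (r : ℂ)⁻¹)⁻¹ = ((Real.exp (-(s.im * b)) + r⁻¹)⁻¹ : ℝ) := by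
        have : s * (b * Complex.I) = ((-(s.im * b) : ℝ) : ℂ) := by
          apply Complex.ext <;> simp [hs]
        rw [hE]
        simp only
        rw [this]
        push_cast
        rfl
      have hp : 0 < (Real.exp (-(s.im * b)) + r⁻¹)⁻¹ := by positivity
      rw [hG]
      simp only
      rw [hreal] at k2 ⊢
      rw [Complex.norm_real, Real.norm_of_nonneg hp.le] at k2
      exact hδ _ hp k2)
    (fun s hs => by
      have hs : s.re = 1 := hs
      exact (hGd s (by linarith) hs.le).2)
  rw [hsre, hG] at main
  simp only at main
  rwa [hEs] at main

/-- Lindelöf's theorem in sectors of opening less than `π`: a function that is holomorphic and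
bounded near the vertex of every closed sector in the right half-plane and tends to zero along the
positive real axis tends to zero in every such sector. -/
theorem Complex.tendsto_zero_of_tendsto_zero_real_of_sector {g : ℂ → ℂ} {M : ℝ}
    (hg : ∀ c : ℝ, 0 < c → ∃ r > 0, ∀ ζ : ℂ, ζ ≠ 0 → ‖ζ‖ < r → c * ‖ζ‖ ≤ ζ.re →
      DifferentiableAt ℂ g ζ ∧ ‖g ζ‖ ≤ M)
    (hrad : Tendsto (fun t : ℝ => g t) (𝓝[>] 0) (𝓝 0)) {c : ℝ} (hc : 0 < c) {ε : ℝ}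
    (hε : 0 < ε) :
    ∃ ρ > 0, ∀ ξ : ℂ, ξ ≠ 0 → ‖ξ‖ < ρ → c * ‖ξ‖ ≤ ξ.re → ‖g ξ‖ < ε := by
  -- The shift by 1/r costs aperture, hence c / 2; the gap between θ and β gives x₀ < 1.
  set θ := Real.arccos (c / 2) with hθ
  have hθ0 : 0 ≤ θ := Real.arccos_nonneg _
  have hθ1 : θ < Real.pi / 2 := Real.arccos_lt_pi_div_two.2 (by linarith)
  obtain ⟨β, hβ1, hβ2⟩ := exists_between hθ1
  have hβ0 : 0 < β := hθ0.trans_lt hβ1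
  have hcos : 0 < Real.cos β := Real.cos_pos_of_mem_Ioo ⟨by linarith, hβ2⟩
  set x₀ := θ / β with hx₀
  have hx₀0 : 0 ≤ x₀ := by positivity
  have hx₀1 : x₀ < 1 := (div_lt_one hβ0).2 hβ1
  -- A base at least 1 makes K^x increasing in x.
  set K := max M 1 with hK
  have hK1 : 1 ≤ K := le_max_right _ _
  obtain ⟨δ, hδ0, hδ1, hδε⟩ : ∃ δ : ℝ, 0 < δ ∧ δ < 1 ∧ δ ^ (1 - x₀) * K ^ x₀ < ε := by
    have h1 : Tendsto (fun δ : ℝ => δ ^ (1 - x₀) * K ^ x₀) (𝓝 0) (𝓝 0) := by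
      have := (Real.continuousAt_rpow_const 0 (1 - x₀) (Or.inr (by linarith))).tendsto
      rw [Real.zero_rpow (by linarith)] at this
      simpa using this.mul_const (K ^ x₀)
    have h2 := ((h1.mono_left (nhdsWithin_le_nhds (s := Ioi 0))).eventually
      (gt_mem_nhds hε)).and ((eventually_nhdsWithin_of_forall fun _ h => h).and
        (nhdsWithin_le_nhds (gt_mem_nhds one_pos)))
    obtain ⟨δ, h3, h4, h5⟩ := h2.exists
    exact ⟨δ, h4, h5, h3⟩
  obtain ⟨r₁, hr₁, hg₁⟩ := hg _ hcos
  obtain ⟨r₂, hr₂, hg₂⟩ := mem_nhdsGT_iff_exists_Ioo_subset.1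
    (hrad.norm.eventually (by simpa using gt_mem_nhds hδ0))
  have hr₂ : 0 < r₂ := hr₂
  set r := min r₁ r₂ with hr
  have hr0 : 0 < r := lt_min hr₁ hr₂
  -- This radius is what makes c‖ξ⁻¹‖ - 1/r ≥ (c/2)(‖ξ⁻¹‖ + 1/r), which puts η in the c / 2 sector.
  refine ⟨r / (2 / c + 1), by positivity, fun ξ hξ hξρ hξc => ?_⟩
  have hξ0 : 0 < ‖ξ‖ := norm_pos_iff.2 hξ
  have hinv : (2 / c + 1) * r⁻¹ < ‖ξ⁻¹‖ := by
    rw [norm_inv, lt_inv_comm₀ (by positivity) hξ0]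
    rwa [mul_inv, inv_inv, mul_comm, ← div_eq_mul_inv]
  have hr' : 0 < r⁻¹ := inv_pos.2 hr0
  have hcinv : c * ((2 / c + 1) * r⁻¹) < c * ‖ξ⁻¹‖ := mul_lt_mul_of_pos_left hinv hc
  have hexp : c * ((2 / c + 1) * r⁻¹) = 2 * r⁻¹ + c * r⁻¹ := by field_simp
  set η := ξ⁻¹ - (r : ℂ)⁻¹ with hη
  have hηre : η.re = (ξ⁻¹).re - r⁻¹ := by
    rw [hη, ← Complex.ofReal_inv]; simp
  have hηn : ‖η‖ ≤ ‖ξ⁻¹‖ + r⁻¹ := by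
    have := norm_sub_le ξ⁻¹ (r : ℂ)⁻¹
    simpa [abs_of_pos hr0] using this
  have hξre := Complex.mul_norm_inv_le_re_inv hξc
  have hηc : c / 2 * ‖η‖ ≤ η.re := by
    have := mul_le_mul_of_nonneg_left hηn (by positivity : 0 ≤ c / 2)
    nlinarith
  have hη0 : η ≠ 0 := by
    intro h
    have : η.re = 0 := by rw [h]; rfl
    nlinarith
  have harg : |η.arg| ≤ θ := Complex.abs_arg_le_arccos hη0 hηc
  have hback : (η + (r : ℂ)⁻¹)⁻¹ = ξ := by rw [hη]; simp
  -- The sign of b selects the half-sector containing η.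
  obtain ⟨b, hb, hbarg⟩ : ∃ b : ℝ, |b| = β ∧ η.arg / b = |η.arg| / β := by
    rcases le_total 0 η.arg with h | h
    · exact ⟨β, abs_of_pos hβ0, by rw [abs_of_nonneg h]⟩
    · exact ⟨-β, by rw [abs_neg, abs_of_pos hβ0], by rw [abs_of_nonpos h, div_neg, neg_div]⟩
  have hx : |η.arg| / β ≤ x₀ := by rw [hx₀]; gcongr
  have main := Complex.norm_le_interp_of_truncated_sector (g := g) (δ := δ) (M := K) hβ2 hβ0 hb hr0
    (fun ζ h1 h2 h3 => by
      obtain ⟨h4, h5⟩ := hg₁ ζ h1 (h2.trans_le (min_le_left _ _)) h3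
      exact ⟨h4, h5.trans (le_max_left _ _)⟩)
    (fun t h1 h2 => (hg₂ ⟨h1, h2.trans_le (min_le_right _ _)⟩ : ‖g t‖ < δ).le)
    hη0 (by rw [hbarg]; positivity) (by rw [hbarg]; linarith)
  rw [hback, hbarg] at main
  refine (main.trans ?_).trans_lt hδε
  refine mul_le_mul ?_ (Real.rpow_le_rpow_of_exponent_le hK1 hx) (by positivity) (by positivity)
  exact Real.rpow_le_rpow_of_exponent_ge hδ0 hδ1.le (by linarith)

/-! ### Boundary geometry at P -/

theorem HasDerivAt.tangent_mem_tangentConeAt {γ : ℝ → ℂ} {v : ℂ} {S : Set ℂ} {x : ℝ}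
    (hγ : HasDerivAt γ v x) (hS : ∀ᶠ y in 𝓝 x, γ y ∈ S) : v ∈ tangentConeAt ℝ S (γ x) := by
  have h := (hγ.hasFDerivAt.hasFDerivWithinAt (s := {y | γ y ∈ S})).mapsTo_tangent_cone
  have hu : (1 : ℝ) ∈ tangentConeAt ℝ {y | γ y ∈ S} x := by
    have h1 : 𝓝[univ] x ≤ 𝓝[{y | γ y ∈ S}] x := by
      rw [nhdsWithin_univ, nhdsWithin_eq_nhds.2 hS]
    exact tangentConeAt_mono_nhds h1 (by rw [tangentConeAt_univ]; trivial)
  have h2 := h hu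
  rw [ContinuousLinearMap.toSpanSingleton_apply, one_smul] at h2
  exact tangentConeAt_mono (by rintro _ ⟨y, hy, rfl⟩; exact hy) h2

/-- Near `P` the boundary is, to first order, the line through `P` orthogonal to the normal: it is
tangent to that line, and every point of the line has a point of the boundary close to it. -/
theorem HasC2Boundary.tangent_line {Ω : Set ℂ} (hΩ : HasC2Boundary Ω) {P ν : ℂ}
    (hP : P ∈ frontier Ω) (hν : IsUnitOutwardNormal Ω P ν) {ε : ℝ} (hε : 0 < ε) :
    ∃ r > 0, (∀ ζ : ℂ, ‖ζ‖ < r → P - ζ * ν ∈ frontier Ω → |ζ.re| ≤ ε * ‖ζ‖) ∧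
      ∀ ζ : ℂ, ‖ζ‖ < r → Metric.infDist (P - ζ * ν) (frontier Ω) ≤ |ζ.re| + ε * ‖ζ‖ := by
  obtain ⟨u, φ, hu, hφ, hgraph⟩ := hΩ P hP
  have hu0 : u ≠ 0 := by rintro rfl; simp at hu
  have hν0 : ν ≠ 0 := by
    rintro rfl; simpa using hν.norm_eq_one
  have hφ0 : φ 0 = 0 := by simpa using (hgraph.self_of_nhds.1 hP).symm
  have hd : HasDerivAt φ (deriv φ 0) 0 := (hφ.differentiableAt (by norm_num)).hasDerivAt
  set m := deriv φ 0 with hm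
  set γ : ℝ → ℂ := fun x => P + u * (x + φ x * Complex.I) with hγ
  have hγ0 : γ 0 = P := by simp [hγ, hφ0]
  have hγd : HasDerivAt γ (u * (1 + m * Complex.I)) 0 := by
    have h1 : HasDerivAt (fun x : ℝ => (x : ℂ)) 1 0 := (hasDerivAt_id (0 : ℝ)).ofReal_comp
    exact ((h1.add (hd.ofReal_comp.mul_const _)).const_mul u).const_add P
  have hγS : ∀ᶠ x in 𝓝 0, γ x ∈ frontier Ω := by
    have h1 : Tendsto γ (𝓝 0) (𝓝 P) := by
      have := hγd.continuousAt.tendsto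
      rwa [hγ0] at this
    filter_upwards [h1.eventually hgraph] with x hx
    rw [hx, hγ]
    simp [hu0]
  have horth := hν.orthogonal _ (hγ0 ▸ hγd.tangent_mem_tangentConeAt hγS)
  -- The tangent vector in units of ν: orthogonality makes it purely imaginary, and its modulus is
  -- √(1 + m²) ≥ 1.
  set q := u * (1 + m * Complex.I) / ν with hq
  have hνn : ν * (starRingEnd ℂ) ν = 1 := by
    rw [Complex.mul_conj, Complex.normSq_eq_norm_sq, hν.norm_eq_one]; simp
  have hqre : q.re = 0 := by
    have h1 : q = u * (1 + m * Complex.I) * (starRingEnd ℂ) ν := by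
      rw [hq, div_eq_iff hν0]
      linear_combination (-u * (1 + m * Complex.I)) * hνn
    rw [h1, ← Complex.inner]
    exact horth
  have hqim : 1 ≤ |q.im| := by
    have h1 : ‖q‖ = ‖(1 + m * Complex.I : ℂ)‖ := by
      rw [hq, norm_div, norm_mul, hu, hν.norm_eq_one]; simp
    have h2 : 1 ≤ ‖q‖ := by
      rw [h1]
      simpa using Complex.abs_re_le_norm (1 + m * Complex.I : ℂ)
    have h3 : q = q.im * Complex.I := by apply Complex.ext <;> simp [hqre]
    rw [h3] at h2
    simpa using h2
  have hqim0 : q.im ≠ 0 := by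
    intro h; rw [h] at hqim; norm_num at hqim
  have hlin : ∀ᶠ x in 𝓝 (0 : ℝ), |φ x - m * x| ≤ ε * |x| := by
    have := (hasDerivAt_iff_isLittleO.1 hd).def hε
    simpa [hφ0, mul_comm] using this
  obtain ⟨r₁, hr₁, h₁⟩ := Metric.eventually_nhds_iff.1 (hlin.and hγS)
  obtain ⟨r₂, hr₂, h₂⟩ := Metric.eventually_nhds_iff.1 hgraph
  have hsplit : ∀ x : ℝ, (γ x - P) / ν = x * q + (φ x - m * x : ℝ) * (u * Complex.I / ν) := by
    intro x
    rw [hγ, hq]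
    simp only
    push_cast
    field_simp
    ring
  have hunit : ‖u * Complex.I / ν‖ = 1 := by
    rw [norm_div, norm_mul, hu, hν.norm_eq_one]; simp
  have herr : ∀ x : ℝ, ‖((φ x - m * x : ℝ) : ℂ) * (u * Complex.I / ν)‖ = |φ x - m * x| := by
    intro x
    rw [norm_mul, hunit, mul_one, Complex.norm_real, Real.norm_eq_abs]
  refine ⟨min r₁ r₂, lt_min hr₁ hr₂, fun ζ hζ hmem => ?_, fun ζ hζ => ?_⟩
  · have hn : ‖-ζ * ν‖ = ‖ζ‖ := by rw [norm_mul, hν.norm_eq_one, norm_neg, mul_one]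
    have hsub : P - ζ * ν - P = -ζ * ν := by ring
    set x := ((P - ζ * ν - P) / u).re with hx
    have hg := (h₂ (by rw [dist_eq_norm, hsub, hn]; exact hζ.trans_le (min_le_right _ _))).1 hmem
    rw [← hx] at hg
    have hxn : |x| ≤ ‖ζ‖ := by
      refine (Complex.abs_re_le_norm _).trans ?_
      rw [hsub, norm_div, hu, hn, div_one]
    have hpt : γ x - P = -ζ * ν := by
      have : (P - ζ * ν - P) / u = x + φ x * Complex.I := by
        rw [← hg, hx, Complex.re_add_im]
      rw [← hsub, hγ]
      simp only
      rw [← this]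
      field_simp
      ring
    have hs := hsplit x
    rw [hpt, mul_div_cancel_right₀ _ hν0] at hs
    have hre : -ζ.re = (((φ x - m * x : ℝ) : ℂ) * (u * Complex.I / ν)).re := by
      have := congrArg Complex.re hs
      rwa [Complex.neg_re, Complex.add_re, Complex.re_ofReal_mul x, hqre, mul_zero, zero_add]
        at this
    have hx1 : dist x 0 < r₁ := by
      rw [Real.dist_0_eq_abs]; exact hxn.trans_lt (hζ.trans_le (min_le_left _ _))
    calc |ζ.re| = |-ζ.re| := (abs_neg _).symm
      _ ≤ |φ x - m * x| := by rw [hre, ← herr]; exact Complex.abs_re_le_norm _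
      _ ≤ ε * |x| := (h₁ hx1).1
      _ ≤ ε * ‖ζ‖ := by gcongr
  -- Chosen so that `γ x` matches the tangential coordinate of P - ζν to first order.
  · set x : ℝ := -ζ.im / q.im with hx
    have hxn : |x| ≤ ‖ζ‖ := by
      rw [hx, abs_div, abs_neg]
      exact (div_le_self (abs_nonneg _) hqim).trans (Complex.abs_im_le_norm ζ)
    have hx1 : dist x 0 < r₁ := by
      rw [Real.dist_0_eq_abs]; exact hxn.trans_lt (hζ.trans_le (min_le_left _ _))
    obtain ⟨hlx, hSx⟩ := h₁ hx1
    refine (Metric.infDist_le_dist_of_mem hSx).trans ?_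
    have hxq : (x : ℂ) * q = -ζ.im * Complex.I := by
      apply Complex.ext
      · simp [hqre]
      · rw [Complex.im_ofReal_mul, hx, div_mul_cancel₀ _ hqim0]; simp
    have hdiff : P - ζ * ν - γ x =
        -(ζ.re + ((φ x - m * x : ℝ) : ℂ) * (u * Complex.I / ν)) * ν := by
      have hs := hsplit x
      rw [hxq, div_eq_iff hν0] at hs
      linear_combination -hs + ν * Complex.re_add_im ζ
    rw [dist_eq_norm, hdiff, norm_mul, hν.norm_eq_one, mul_one, norm_neg]
    refine (norm_add_le _ _).trans ?_
    rw [herr, Complex.norm_real, Real.norm_eq_abs]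
    have : ε * |x| ≤ ε * ‖ζ‖ := by gcongr
    linarith

theorem convex_sector (c r : ℝ) (hc : 0 ≤ c) :
    Convex ℝ {ζ : ℂ | c * ‖ζ‖ < ζ.re ∧ ‖ζ‖ < r} := by
  rintro z ⟨hz, hz'⟩ w ⟨hw, hw'⟩ a b ha hb hab
  have hn : ‖a • z + b • w‖ ≤ a * ‖z‖ + b * ‖w‖ := by
    refine (norm_add_le _ _).trans ?_
    rw [norm_smul, norm_smul, Real.norm_of_nonneg ha, Real.norm_of_nonneg hb]
  have hab' : 0 < a ∨ 0 < b := by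
    by_contra! h
    linarith [h.1, h.2]
  refine ⟨?_, ?_⟩
  · have hre : (a • z + b • w).re = a * z.re + b * w.re := by simp
    rw [hre]
    have := mul_le_mul_of_nonneg_left hn hc
    rcases hab' with h | h <;> nlinarith
  · simpa using convex_ball (0 : ℂ) r (by simpa using hz') (by simpa using hw') ha hb hab

/-- A sector at a boundary point around a unit vector `-ν` that meets the boundary only to first
order stays inside any open set that contains the axis of the sector near the vertex. -/
theorem sector_subset_of_axis {Ω U : Set ℂ} {P ν : ℂ} {c r : ℝ} (hc : 0 < c) (hc1 : c < 1)
    (hU : IsOpen U) (hUΩ : frontier U ⊆ frontier Ω) (hr : 0 < r)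
    (hflat : ∀ ζ : ℂ, ‖ζ‖ < r → P - ζ * ν ∈ frontier Ω → |ζ.re| ≤ c * ‖ζ‖)
    (haxis : ∀ᶠ t : ℝ in 𝓝[>] 0, P - (t : ℂ) * ν ∈ U) {ζ : ℂ} (hζ : ‖ζ‖ < r)
    (hζc : c * ‖ζ‖ < ζ.re) : P - ζ * ν ∈ U := by
  set S := (fun ζ : ℂ => P - ζ * ν) '' {ζ : ℂ | c * ‖ζ‖ < ζ.re ∧ ‖ζ‖ < r} with hS
  have hpre : IsPreconnected S :=
    (convex_sector c r hc.le).isPreconnected.image _ (by fun_prop)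
  have hne : (S ∩ U).Nonempty := by
    obtain ⟨t, ht, ht0, htr⟩ := (haxis.and ((eventually_nhdsWithin_of_forall fun _ h => h).and
        (nhdsWithin_le_nhds (gt_mem_nhds hr)))).exists
    have ht0 : 0 < t := ht0
    refine ⟨_, ⟨(t : ℂ), ⟨?_, ?_⟩, rfl⟩, ht⟩
    · rw [Complex.norm_real, Real.norm_of_nonneg ht0.le, Complex.ofReal_re]; nlinarith
    · rwa [Complex.norm_real, Real.norm_of_nonneg ht0.le]
  -- A connected set that meets U but not its frontier lies in U.
  refine hpre.subset_of_closure_inter_subset hU hne ?_ ⟨ζ, ⟨hζc, hζ⟩, rfl⟩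
  rintro _ ⟨hcl, ξ, ⟨h1, h2⟩, rfl⟩
  by_contra hnot
  have hfr : P - ξ * ν ∈ frontier U := ⟨hcl, by rwa [hU.interior_eq]⟩
  have := hflat ξ h2 (hUΩ hfr)
  linarith [le_abs_self ξ.re]

/-! ### From sectors to approach regions -/

theorem theorem19 (Ω₁ Ω₂ : Set ℂ)
    (hΩ₁ : IsBoundedDomain Ω₁) (hΩ₁' : HasC2Boundary Ω₁)
    (hΩ₂ : IsBoundedDomain Ω₂) (hΩ₂' : HasC2Boundary Ω₂)
    (f : ℂ → ℂ) (hf : DifferentiableOn ℂ f Ω₁) (hmaps : MapsTo f Ω₁ Ω₂)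
    (P Q : ℂ) (hP : P ∈ frontier Ω₁) (hQ : Q ∈ frontier Ω₂)
    (hrad : HasRadialLimit Ω₁ f P Q) :
    HasNontangentialLimit Ω₁ f P Q := by
  obtain ⟨ν, hν, hlim⟩ := hrad
  obtain ⟨M, hM⟩ := hΩ₂.isBounded.exists_norm_le
  have hν0 : ν ≠ 0 := by
    rintro rfl; simpa using hν.norm_eq_one
  have hsector : ∀ c : ℝ, 0 < c → ∃ r > 0, ∀ ζ : ℂ, ζ ≠ 0 → ‖ζ‖ < r → c * ‖ζ‖ ≤ ζ.re →
      P - ζ * ν ∈ Ω₁ ∧ P + ζ * ν ∉ closure Ω₁ := by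
    intro c hc
    obtain ⟨r, hr, hflat, -⟩ := hΩ₁'.tangent_line hP hν
      (show 0 < min (c / 2) (1 / 2) by positivity)
    have hc1 : min (c / 2) (1 / 2) < 1 := (min_le_right _ _).trans_lt (by norm_num)
    refine ⟨r, hr, fun ζ hζ0 hζr hζc => ?_⟩
    have hn : 0 < ‖ζ‖ := norm_pos_iff.2 hζ0
    have hζc' : min (c / 2) (1 / 2) * ‖ζ‖ < ζ.re := by
      have : min (c / 2) (1 / 2) * ‖ζ‖ ≤ c / 2 * ‖ζ‖ := by gcongr; exact min_le_left _ _
      nlinarith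
    refine ⟨sector_subset_of_axis (by positivity) hc1 hΩ₁.isOpen subset_rfl hr hflat hν.inside
      hζr hζc', ?_⟩
    -- The same argument for the exterior, with the normal reversed.
    have := sector_subset_of_axis (Ω := Ω₁) (U := (closure Ω₁)ᶜ) (P := P) (ν := -ν)
      (by positivity) hc1 isClosed_closure.isOpen_compl
      (by rw [frontier_compl]; exact frontier_closure_subset) hr
      (fun ξ h1 h2 => by
        simpa using hflat (-ξ) (by rwa [norm_neg]) (by rwa [neg_mul, ← mul_neg]))
      (by simpa using hν.outside) hζr hζc'
    rwa [mul_neg, sub_neg_eq_add] at this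
  intro α hα
  have hα0 : 0 < α := by linarith
  -- With this c, ‖ζ‖ < α(|Re ζ| + c‖ζ‖) absorbs to ‖ζ‖/2 ≤ α|Re ζ|.
  set c := 1 / (2 * α) with hc
  have hc0 : 0 < c := by positivity
  have hcα : c * α = 1 / 2 := by rw [hc]; field_simp
  obtain ⟨r₁, hr₁, -, hdist⟩ := hΩ₁'.tangent_line hP hν hc0
  obtain ⟨r₂, hr₂, hcone⟩ := hsector c hc0
  have hcenter : Tendsto (fun t : ℝ => f (P - (t : ℂ) * ν) - Q) (𝓝[>] 0) (𝓝 0) := by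
    simpa using hlim.sub_const Q
  have hbdd : ∀ c : ℝ, 0 < c → ∃ r > 0, ∀ ζ : ℂ, ζ ≠ 0 → ‖ζ‖ < r → c * ‖ζ‖ ≤ ζ.re →
      DifferentiableAt ℂ (fun ζ => f (P - ζ * ν) - Q) ζ ∧ ‖f (P - ζ * ν) - Q‖ ≤ M + ‖Q‖ := by
    intro c hc
    obtain ⟨r, hr, h⟩ := hsector c hc
    refine ⟨r, hr, fun ζ h0 h1 h2 => ?_⟩
    have hmem := (h ζ h0 h1 h2).1
    refine ⟨?_, (norm_sub_le _ _).trans (by gcongr; exact hM _ (hmaps hmem))⟩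
    have hfd : DifferentiableAt ℂ f (P - ζ * ν) :=
      hf.differentiableAt (hΩ₁.isOpen.mem_nhds hmem)
    exact (DifferentiableAt.comp ζ hfd (by fun_prop)).sub_const Q
  rw [Metric.tendsto_nhdsWithin_nhds]
  intro ε hε
  obtain ⟨ρ, hρ, hsmall⟩ := Complex.tendsto_zero_of_tendsto_zero_real_of_sector hbdd hcenter hc0 hε
  refine ⟨min ρ (min r₁ r₂), lt_min hρ (lt_min hr₁ hr₂), ?_⟩
  rintro z ⟨hzΩ, hzα⟩ hzP
  obtain ⟨ζ, rfl⟩ : ∃ ζ : ℂ, P - ζ * ν = z := ⟨(P - z) / ν, by field_simp; ring⟩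
  have hn : ‖P - ζ * ν - P‖ = ‖ζ‖ := by
    rw [sub_sub_cancel_left, norm_neg, norm_mul, hν.norm_eq_one, mul_one]
  rw [dist_eq_norm, hn] at hzP
  rw [hn] at hzα
  have hz1 := hzP.trans_le (min_le_left _ _)
  have hz2 := hzP.trans_le ((min_le_right _ _).trans (min_le_left _ _))
  have hz3 := hzP.trans_le ((min_le_right _ _).trans (min_le_right _ _))
  have hζ0 : ζ ≠ 0 := by
    rintro rfl
    rw [zero_mul, sub_zero] at hzΩ
    exact hP.2 (by rwa [hΩ₁.isOpen.interior_eq])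
  have habs : c * ‖ζ‖ ≤ |ζ.re| := by
    have h1 := mul_le_mul_of_nonneg_left (hdist ζ hz2) hα0.le
    have h2 : ‖ζ‖ / 2 ≤ α * |ζ.re| := by
      have : α * (|ζ.re| + c * ‖ζ‖) = α * |ζ.re| + ‖ζ‖ / 2 := by
        linear_combination ‖ζ‖ * hcα
      linarith
    rw [hc, one_div_mul_eq_div, div_le_iff₀ (by positivity)]
    linarith
  -- A negative real part would place z in the exterior sector.
  have hre : c * ‖ζ‖ ≤ ζ.re := by
    rcases le_total 0 ζ.re with h | h
    · rwa [abs_of_nonneg h] at habs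
    · rw [abs_of_nonpos h] at habs
      refine absurd (subset_closure hzΩ) ?_
      have := (hcone (-ζ) (neg_ne_zero.2 hζ0) (by rwa [norm_neg]) (by simpa using habs)).2
      rwa [neg_mul, ← sub_eq_add_neg] at this
  rw [dist_eq_norm]
  exact hsmall ζ hζ0 hz1 hre
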